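/- Let $g:\mathbb{R}^m\to[0,\infty)$ be lower semicontinuous and positive definite ($g(0)=0$ and $g(y)>0$ for $y\neq 0$), let $F:\mathbb{R}^n\to\mathbb{R}^m$, and put $f=g\circ F$ and $M=[f=0]=\{x\in\mathbb{R}^n: f(x)=0\}$. Let $\overline{x}\in M$, let $F$ be $C^2$ near $\overline{x}$, and put $\overline{y}=F(\overline{x})$. Let $U\subseteq\mathbb{R}^n$ be an open set containing $\overline{x}$, and let $V\subseteq\mathbb{R}^m$ be a set with $F(U)\subseteq V$ that is a $C^2$ embedded submanifold of $\mathbb{R}^m$ near $\overline{y}$. Suppose that the differential $d\widetilde F_{\overline{x}}:\mathbb{R}^n\to T_{\overline{y}}V$ of the restriction $\widetilde F:U\to V$ of $F$ is surjective and that $F^{-1}(\overline{y})\subseteq U$. Then $M$ is a $C^2$ embedded submanifold of $\mathbb{R}^n$ near $\overline{x}$, and $f$ satisfies the normalized perturbed projection formula at $\overline{x}$ along $M$, that is, there are $c,r>0$ such that $$|P_{T_xM}(u)|\le c\,|x-y|\qquad\text{for all } x\in M\cap B_r(\overline{x}),\ y\in B_r(\overline{x}),\ u\in\widehat\nabla f(y).$$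 Here $P_{T_xM}$ is the orthogonal projection onto the tangent space $T_xM\subseteq\mathbb{R}^n$, and $\widehat\nabla f$ is the normalized subdifferential of $f$, i.e. the set-valued map whose graph is the closure in $\mathbb{R}^n\times\mathbb{R}^n$ of the graph of $\widetilde\nabla f$, where $\widetilde\nabla f(y)=\{\nabla f(y)/|\nabla f(y)|\}$ if $f$ is differentiable at $y$ with $\nabla f(y)\ne 0$, $\widetilde\nabla f(y)=\{0\}$ if $f$ is constant near $y$, and $\widetilde\nabla f(y)=\emptyset$ otherwise. -/

import Mathlib

open Set Filter Topology

/-- `V` is a `C^k` embedded submanifold of `ℝᵈ` near its point `p`: some open neighbourhood of `p`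
carries a slice chart, i.e. a `C^k` diffeomorphism `φ` onto an open subset of `ℝᵈ` which maps the
part of `V` in that neighbourhood onto the part in `φ.target` of a linear subspace `S`. -/
def IsEmbeddedSubmanifoldNear {d : ℕ} (k : ℕ∞) (V : Set (EuclideanSpace ℝ (Fin d)))
    (p : EuclideanSpace ℝ (Fin d)) : Prop :=
  p ∈ V ∧
    ∃ (φ : OpenPartialHomeomorph (EuclideanSpace ℝ (Fin d)) (EuclideanSpace ℝ (Fin d)))
      (S : Submodule ℝ (EuclideanSpace ℝ (Fin d))),
      p ∈ φ.source ∧ ContDiffOn ℝ k φ φ.source ∧ ContDiffOn ℝ k φ.symm φ.target ∧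
        ∀ x ∈ φ.source, x ∈ V ↔ φ x ∈ S

/-- The velocities at time `0` of the `C¹` curves through `p` that run in `V`. -/
def curveVelocities {d : ℕ} (V : Set (EuclideanSpace ℝ (Fin d)))
    (p : EuclideanSpace ℝ (Fin d)) : Set (EuclideanSpace ℝ (Fin d)) :=
  {v | ∃ γ : ℝ → EuclideanSpace ℝ (Fin d),
    ContDiffAt ℝ 1 γ 0 ∧ γ 0 = p ∧ (∀ᶠ t in 𝓝 (0 : ℝ), γ t ∈ V) ∧ deriv γ 0 = v}

/-- The tangent space `T_p V`, as a linear subspace of the ambient space. Where `V` is an embedded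
submanifold the set of velocities is already a linear subspace, so that the span adds nothing
(see `coe_tangentSpaceOf`). -/
def tangentSpaceOf {d : ℕ} (V : Set (EuclideanSpace ℝ (Fin d)))
    (p : EuclideanSpace ℝ (Fin d)) : Submodule ℝ (EuclideanSpace ℝ (Fin d)) :=
  Submodule.span ℝ (curveVelocities V p)

theorem exists_curveVelocities_eq {d : ℕ} {V : Set (EuclideanSpace ℝ (Fin d))}
    {p : EuclideanSpace ℝ (Fin d)} (h : IsEmbeddedSubmanifoldNear 1 V p) :
    ∃ T : Submodule ℝ (EuclideanSpace ℝ (Fin d)), (T : Set _) = curveVelocities V p := by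
  obtain ⟨hpV, φ, S, hp, h1, h2, hS⟩ := h
  have hpt : φ p ∈ φ.target := φ.map_source hp
  have hφ : ContDiffAt ℝ 1 φ p := h1.contDiffAt (φ.open_source.mem_nhds hp)
  have hψ : ContDiffAt ℝ 1 φ.symm (φ p) := h2.contDiffAt (φ.open_target.mem_nhds hpt)
  have hφd : HasFDerivAt φ (fderiv ℝ φ p) p := (hφ.differentiableAt one_ne_zero).hasFDerivAt
  have hψd : HasFDerivAt φ.symm (fderiv ℝ φ.symm (φ p)) (φ p) :=
    (hψ.differentiableAt one_ne_zero).hasFDerivAt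
  have hpS : φ p ∈ S := (hS p hp).1 hpV
  refine ⟨S.map (fderiv ℝ φ.symm (φ p) : _ →ₗ[ℝ] EuclideanSpace ℝ (Fin d)), ?_⟩
  ext v
  constructor
  · rintro ⟨s, hs, rfl⟩
    have hline : HasDerivAt (fun t : ℝ => φ p + t • s) s 0 := by
      simpa using ((hasDerivAt_id (0 : ℝ)).smul_const s).const_add (φ p)
    have hlc : ContDiff ℝ 1 (fun t : ℝ => φ p + t • s) := by fun_prop
    have h0 : φ p + (0 : ℝ) • s = φ p := by simp
    refine ⟨fun t => φ.symm (φ p + t • s), ?_, ?_, ?_, ?_⟩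
    · refine ContDiffAt.comp (g := φ.symm) (0 : ℝ) ?_ hlc.contDiffAt
      rw [h0]; exact hψ
    · simp [φ.left_inv hp]
    · have : ∀ᶠ t in 𝓝 (0 : ℝ), φ p + t • s ∈ φ.target := by
        refine hlc.continuous.continuousAt.eventually_mem ?_
        rw [h0]; exact φ.open_target.mem_nhds hpt
      filter_upwards [this] with t ht
      rw [hS _ (φ.map_target ht), φ.right_inv ht]
      exact S.add_mem hpS (S.smul_mem t hs)
    · exact (HasFDerivAt.comp_hasDerivAt (l := φ.symm) (0 : ℝ) (by rw [h0]; exact hψd) hline).deriv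
  · rintro ⟨γ, hγ, hγ0, hγV, rfl⟩
    have hγd : HasDerivAt γ (deriv γ 0) 0 := (hγ.differentiableAt one_ne_zero).hasDerivAt
    have hc : HasDerivAt (fun t => φ (γ t)) (fderiv ℝ φ p (deriv γ 0)) 0 :=
      HasFDerivAt.comp_hasDerivAt (l := φ) (0 : ℝ) (by rw [hγ0]; exact hφd) hγd
    have hsrc : ∀ᶠ t in 𝓝 (0 : ℝ), γ t ∈ φ.source :=
      hγ.continuousAt.eventually_mem (by rw [hγ0]; exact φ.open_source.mem_nhds hp)
    have hin : ∀ᶠ t in 𝓝 (0 : ℝ), φ (γ t) ∈ S := by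
      filter_upwards [hγV, hsrc] with t ht hts
      exact (hS _ hts).1 ht
    refine ⟨fderiv ℝ φ p (deriv γ 0), ?_, ?_⟩
    · have hcl : IsClosed (S : Set (EuclideanSpace ℝ (Fin d))) := S.closed_of_finiteDimensional
      refine hcl.mem_of_tendsto (hasDerivAt_iff_tendsto_slope.1 hc) ?_
      filter_upwards [hin.filter_mono nhdsWithin_le_nhds] with t ht
      simp only [slope, vsub_eq_sub, hγ0]
      exact S.smul_mem _ (S.sub_mem ht hpS)
    · have hback : HasDerivAt (fun t => φ.symm (φ (γ t)))
          (fderiv ℝ φ.symm (φ p) (fderiv ℝ φ p (deriv γ 0))) 0 :=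
        HasFDerivAt.comp_hasDerivAt (l := φ.symm) (0 : ℝ) (by rw [hγ0]; exact hψd) hc
      refine (hback.congr_of_eventuallyEq ?_).unique hγd |>.trans rfl
      filter_upwards [hsrc] with t ht
      exact (φ.left_inv ht).symm

theorem coe_tangentSpaceOf {d : ℕ} {V : Set (EuclideanSpace ℝ (Fin d))}
    {p : EuclideanSpace ℝ (Fin d)} (h : IsEmbeddedSubmanifoldNear 1 V p) :
    (tangentSpaceOf V p : Set (EuclideanSpace ℝ (Fin d))) = curveVelocities V p := by
  obtain ⟨T, hT⟩ := exists_curveVelocities_eq h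
  rw [tangentSpaceOf, ← hT, Submodule.span_eq]

/-- A real function on `ℝᵐ` is positive definite if it vanishes at `0` and is positive elsewhere. -/
def IsPositiveDefiniteFun {m : ℕ} (g : EuclideanSpace ℝ (Fin m) → ℝ) : Prop :=
  g 0 = 0 ∧ ∀ y, y ≠ 0 → 0 < g y

/-- The set-valued map `∇̃f`: the normalized gradient where `f` is differentiable with nonzero
gradient, `0` where `f` is locally constant, empty elsewhere. -/
def preNormalizedSubdiff {n : ℕ} (f : EuclideanSpace ℝ (Fin n) → ℝ)
    (x : EuclideanSpace ℝ (Fin n)) : Set (EuclideanSpace ℝ (Fin n)) :=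
  {u | (DifferentiableAt ℝ f x ∧ gradient f x ≠ 0 ∧ u = ‖gradient f x‖⁻¹ • gradient f x) ∨
    ((∀ᶠ y in 𝓝 x, f y = f x) ∧ u = 0)}

/-- The normalized subdifferential `∇̂f`: the set-valued map whose graph is the closure of the
graph of `∇̃f`. -/
def normalizedSubdiff {n : ℕ} (f : EuclideanSpace ℝ (Fin n) → ℝ)
    (x : EuclideanSpace ℝ (Fin n)) : Set (EuclideanSpace ℝ (Fin n)) :=
  {u | (x, u) ∈ closure {q : EuclideanSpace ℝ (Fin n) × EuclideanSpace ℝ (Fin n) |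
    q.2 ∈ preNormalizedSubdiff f q.1}}

/-- The normalized perturbed projection formula for `f` at `a` along `X`: near its point `a`, the
set `X` is an embedded submanifold (at least `C¹`, so that it has tangent spaces); `f` is constant
on `X` (hence `f|_X` is smooth); and `|P_{T_x X}(u)| = O(|x - y|)` for all `u ∈ ∇̂f(y)`, for
`x ∈ X` and `y ∈ ℝⁿ` near `a`. -/
def NormalizedPerturbedProjectionFormula {n : ℕ} (f : EuclideanSpace ℝ (Fin n) → ℝ)
    (a : EuclideanSpace ℝ (Fin n)) (X : Set (EuclideanSpace ℝ (Fin n))) : Prop :=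
  IsEmbeddedSubmanifoldNear 1 X a ∧ (∀ x ∈ X, f x = f a) ∧
    ∃ c r : ℝ, 0 < c ∧ 0 < r ∧
      ∀ x ∈ X ∩ Metric.ball a r, ∀ y ∈ Metric.ball a r, ∀ u ∈ normalizedSubdiff f y,
        ‖(tangentSpaceOf X x).starProjection u‖ ≤ c * ‖x - y‖

/-! Composing `F` with a slice chart of `V` and projecting onto the slice `S` gives a `C²`
submersion `H` near `a`. As `F` maps `U` into `V`, `H` and `F` have the same level sets near `a`: so
`f = g ∘ F` is constant on those of `H`, and `M` is the one through `a`. Hence a gradient of `f` at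
`y` is orthogonal to `ker dH_y` (`fderiv_apply_eq_zero_of_straightening`), while a `v` tangent to
`M` at `x` lies in `ker dH_x`. Since `dH` is Lipschitz, `dH_y v` is `O(|x - y| |v|)`, so `v` differs
from an element of `ker dH_y` by some `v'` of that size (`ContinuousAt.exists_bounded_preimage`).
Thus `⟨u, v⟩ = ⟨u, v'⟩` is `O(|x - y| |v|)` for a unit gradient `u`, and the bound survives the
closure of the graph (`normalizedSubdiff_induction`). -/

/-! ### Straightening submersions -/

/-- Near a point where its differential is onto, a `C^k` map is straightened by a `C^k`
diffeomorphism: after it, the map is its own differential at the point. -/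
theorem ContDiffAt.exists_straightening {E S : Type*} [NormedAddCommGroup E] [NormedSpace ℝ E]
    [FiniteDimensional ℝ E] [NormedAddCommGroup S] [NormedSpace ℝ S] [FiniteDimensional ℝ S]
    {k : ℕ} (hk : 1 ≤ k) {H : E → S} {a : E} (hH : ContDiffAt ℝ k H a)
    (hs : Function.Surjective (fderiv ℝ H a)) {W : Set E} (hW : W ∈ 𝓝 a) :
    ∃ φ : OpenPartialHomeomorph E E, a ∈ φ.source ∧ φ.source ⊆ W ∧
      ContDiffOn ℝ k φ φ.source ∧ ContDiffOn ℝ k φ.symm φ.target ∧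
      ∀ x, fderiv ℝ H a (φ x) = H x - H a := by
  have : CompleteSpace E := FiniteDimensional.complete ℝ E
  have hk0 : (k : WithTop ℕ∞) ≠ 0 := by exact_mod_cast (show k ≠ 0 by omega)
  obtain ⟨R, hR⟩ := (fderiv ℝ H a : E →ₗ[ℝ] S).exists_rightInverse_of_surjective
    (LinearMap.range_eq_top.2 hs)
  set B := fderiv ℝ H a with hB
  have hBR : ∀ s, B (R s) = s := fun s => LinearMap.congr_fun hR s
  set R' : S →L[ℝ] E := LinearMap.toContinuousLinearMap R with hR'
  have hBR' : ∀ s, B (R' s) = s := hBR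
  -- With `R'` a right inverse of `B`, the correction term makes `B (Φ x) = H x - H a` exactly, and
  -- its derivative at `a` vanishes, so `dΦ_a = id`.
  set Φ : E → E := fun x => x - a + R' (H x - H a - B (x - a)) with hΦ
  have hΦc : ContDiffAt ℝ k Φ a := by
    have : ContDiffAt ℝ k (fun x => H x - H a - B (x - a)) a :=
      (hH.sub contDiffAt_const).sub (B.contDiff.contDiffAt.comp a (contDiffAt_id.sub contDiffAt_const))
    exact (contDiffAt_id.sub contDiffAt_const).add (R'.contDiff.contDiffAt.comp a this)
  have hΦd : HasFDerivAt Φ ((ContinuousLinearEquiv.refl ℝ E : E ≃L[ℝ] E) : E →L[ℝ] E) a := by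
    have h1 : HasFDerivAt H B a := (hH.differentiableAt hk0).hasFDerivAt
    have h2 : HasFDerivAt (fun x : E => x - a) (ContinuousLinearMap.id ℝ E) a :=
      (hasFDerivAt_id a).sub_const a
    have h3 := h2.add (R'.hasFDerivAt.comp a ((h1.sub_const (H a)).sub (B.hasFDerivAt.comp a h2)))
    refine h3.congr_fderiv ?_
    ext v
    simp
  -- The inverse is `C^k` at the images of the points where `Φ` is `C^k` with invertible derivative;
  -- the chart is restricted to such points.
  have hev : ∀ᶠ x in 𝓝 a, x ∈ W ∧ ContDiffAt ℝ k Φ x ∧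
      ∃ e : E ≃L[ℝ] E, (e : E →L[ℝ] E) = fderiv ℝ Φ x := by
    refine Filter.Eventually.and hW ((hΦc.eventually (by simp)).and ?_)
    have hc : ContinuousAt (fderiv ℝ Φ) a := hΦc.continuousAt_fderiv hk0
    have := hc.eventually_mem (s := range ((↑) : (E ≃L[ℝ] E) → E →L[ℝ] E))
      (by rw [hΦd.fderiv]; exact ContinuousLinearEquiv.nhds _)
    exact this
  let φ₀ := hΦc.toOpenPartialHomeomorph Φ hΦd hk0
  have hφ₀ : ∀ x, φ₀ x = Φ x := fun x => rfl
  have ha₀ : a ∈ φ₀.source := hΦc.mem_toOpenPartialHomeomorph_source hΦd hk0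
  let φ := φ₀.restr {x | x ∈ W ∧ ContDiffAt ℝ k Φ x ∧
      ∃ e : E ≃L[ℝ] E, (e : E →L[ℝ] E) = fderiv ℝ Φ x}
  have hsrc : ∀ x ∈ φ.source, x ∈ W ∧ ContDiffAt ℝ k Φ x ∧
      ∃ e : E ≃L[ℝ] E, (e : E →L[ℝ] E) = fderiv ℝ Φ x := by
    intro x hx
    exact interior_subset (s := {x | x ∈ W ∧ ContDiffAt ℝ k Φ x ∧
      ∃ e : E ≃L[ℝ] E, (e : E →L[ℝ] E) = fderiv ℝ Φ x}) hx.2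
  have hφ : ∀ x, φ x = Φ x := fun x => rfl
  refine ⟨φ, ⟨ha₀, mem_interior_iff_mem_nhds.2 hev⟩, fun x hx => (hsrc x hx).1,
    fun x hx => (hsrc x hx).2.1.contDiffWithinAt, fun y hy => ?_, fun x => ?_⟩
  · obtain ⟨-, hc, e, he⟩ := hsrc _ (φ.map_target hy)
    have hd : HasFDerivAt φ (e : E →L[ℝ] E) (φ.symm y) := by
      rw [he]; exact (hc.differentiableAt hk0).hasFDerivAt
    exact (φ.contDiffAt_symm hy hd hc).contDiffWithinAt
  · simp only [hφ, hΦ, map_add, hBR']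
    abel

/-- A function that is constant on the level sets of a straightened map `H` has a differential
which vanishes on the kernel of the differential of `H`. -/
theorem fderiv_apply_eq_zero_of_straightening {E S : Type*} [NormedAddCommGroup E]
    [NormedSpace ℝ E] [NormedAddCommGroup S] [NormedSpace ℝ S] {H : E → S} {f : E → ℝ}
    {φ : OpenPartialHomeomorph E E} {B : E →L[ℝ] S} {b : S}
    (hφ : ContDiffOn ℝ 1 φ φ.source) (hψ : ContDiffOn ℝ 1 φ.symm φ.target)
    (hB : ∀ x, B (φ x) = H x - b)
    (hf : ∀ x ∈ φ.source, ∀ y ∈ φ.source, H x = H y → f x = f y)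
    {y v : E} (hy : y ∈ φ.source) (hfy : DifferentiableAt ℝ f y) (hv : fderiv ℝ H y v = 0) :
    fderiv ℝ f y v = 0 := by
  have hyt := φ.map_source hy
  have hφd : HasFDerivAt φ (fderiv ℝ φ y) y :=
    ((hφ.contDiffAt (φ.open_source.mem_nhds hy)).differentiableAt one_ne_zero).hasFDerivAt
  have hψd : HasFDerivAt φ.symm (fderiv ℝ φ.symm (φ y)) (φ y) :=
    ((hψ.contDiffAt (φ.open_target.mem_nhds hyt)).differentiableAt one_ne_zero).hasFDerivAt
  have hBv : B (fderiv ℝ φ y v) = 0 := by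
    have hH : HasFDerivAt H (B.comp (fderiv ℝ φ y)) y := by
      have := (B.hasFDerivAt.comp y hφd).add_const b
      refine this.congr_of_eventuallyEq (Eventually.of_forall fun x => ?_)
      simp [hB]
    rw [hH.fderiv] at hv
    exact hv
  -- Since `B w = 0`, the line `φ y + t • w` pulls back to a curve through `y` with velocity `v`
  -- inside one level set of `H`; `f` is constant along it.
  set w := fderiv ℝ φ y v with hw
  have hline : HasDerivAt (fun t : ℝ => φ y + t • w) w 0 := by
    simpa using ((hasDerivAt_id (0 : ℝ)).smul_const w).const_add (φ y)
  have h0 : φ y + (0 : ℝ) • w = φ y := by simp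
  have hψφ : fderiv ℝ φ.symm (φ y) w = v := by
    have h1 : HasFDerivAt (fun x => φ.symm (φ x))
        ((fderiv ℝ φ.symm (φ y)).comp (fderiv ℝ φ y)) y := hψd.comp y hφd
    have h2 : HasFDerivAt (fun x => φ.symm (φ x)) (ContinuousLinearMap.id ℝ E) y :=
      (hasFDerivAt_id y).congr_of_eventuallyEq <| by
        filter_upwards [φ.open_source.mem_nhds hy] with x hx using φ.left_inv hx
    exact DFunLike.congr_fun (h1.unique h2) v
  have hγ : HasDerivAt (fun t : ℝ => φ.symm (φ y + t • w)) v 0 := by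
    have := HasFDerivAt.comp_hasDerivAt (l := φ.symm) (0 : ℝ) (by rw [h0]; exact hψd) hline
    rwa [hψφ] at this
  have hγ0 : φ.symm (φ y + (0 : ℝ) • w) = y := by rw [h0, φ.left_inv hy]
  have hfγ : HasDerivAt (fun t : ℝ => f (φ.symm (φ y + t • w))) (fderiv ℝ f y v) 0 :=
    HasFDerivAt.comp_hasDerivAt (l := f) (0 : ℝ) (by rw [hγ0]; exact hfy.hasFDerivAt) hγ
  have htgt : ∀ᶠ t in 𝓝 (0 : ℝ), φ y + t • w ∈ φ.target :=
    hline.continuousAt.eventually_mem (by rw [h0]; exact φ.open_target.mem_nhds hyt)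
  refine hfγ.unique ((hasDerivAt_const (0 : ℝ) (f y)).congr_of_eventuallyEq ?_)
  filter_upwards [htgt] with t ht
  refine hf _ (φ.map_target ht) _ hy ?_
  have h1 := hB (φ.symm (φ y + t • w))
  rw [φ.right_inv ht, map_add, map_smul, hBv, smul_zero, add_zero, hB] at h1
  exact (sub_left_inj.1 h1).symm

/-! ### Estimates for linear maps and tangent vectors -/

/-- Continuous families of linear maps have preimages of uniformly bounded norm near a parameter
at which the map is onto. -/
theorem ContinuousAt.exists_bounded_preimage {X E S : Type*} [TopologicalSpace X]
    [NormedAddCommGroup E] [NormedSpace ℝ E] [NormedAddCommGroup S] [NormedSpace ℝ S]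
    [FiniteDimensional ℝ S] {B : X → E →L[ℝ] S} {a : X} (hB : ContinuousAt B a)
    (hs : Function.Surjective (B a)) :
    ∃ C : ℝ, 0 < C ∧ ∀ᶠ y in 𝓝 a, ∀ s, ∃ v, B y v = s ∧ ‖v‖ ≤ C * ‖s‖ := by
  have : CompleteSpace S := FiniteDimensional.complete ℝ S
  obtain ⟨R₀, hR₀⟩ := (B a : E →ₗ[ℝ] S).exists_rightInverse_of_surjective
    (LinearMap.range_eq_top.2 hs)
  let R : S →L[ℝ] E := LinearMap.toContinuousLinearMap R₀
  -- `T a` is the identity, so `T y` is invertible near `a` and `R ∘ (T y)⁻¹` is a right inverse of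
  -- `B y` whose norm is continuous at `a`.
  let T : X → S →L[ℝ] S := fun y => (B y).comp R
  have hTa : T a = 1 := ContinuousLinearMap.ext fun s => LinearMap.congr_fun hR₀ s
  have hT : ContinuousAt T a := hB.clm_comp continuousAt_const
  have hunit : ∀ᶠ y in 𝓝 a, IsUnit (T y) :=
    hT.eventually_mem (Units.isOpen.mem_nhds (by rw [hTa]; exact isUnit_one))
  have hinv : ContinuousAt (fun y => Ring.inverse (T y)) a := by
    refine ContinuousAt.comp (g := Ring.inverse) ?_ hT
    rw [hTa]
    exact NormedRing.inverse_continuousAt 1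
  have hQ : ContinuousAt (fun y => ‖R.comp (Ring.inverse (T y))‖) a :=
    (continuousAt_const.clm_comp hinv).norm
  refine ⟨‖R.comp (Ring.inverse (T a))‖ + 1, by positivity, ?_⟩
  filter_upwards [hunit, hQ.eventually_lt_const (lt_add_one _)] with y hy hlt s
  refine ⟨R.comp (Ring.inverse (T y)) s, ?_, ?_⟩
  · exact DFunLike.congr_fun (Ring.mul_inverse_cancel _ hy) s
  · exact (ContinuousLinearMap.le_opNorm _ _).trans (by gcongr)

/-- Test with `v` the projection of `u`, for which the inner product is the square of its norm. -/
theorem norm_starProjection_le_of_inner_le {E : Type*} [NormedAddCommGroup E]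
    [InnerProductSpace ℝ E] {T : Submodule ℝ E} [T.HasOrthogonalProjection] {u : E} {c : ℝ}
    (h : ∀ v ∈ T, inner ℝ u v ≤ c * ‖v‖) (hc : 0 ≤ c) : ‖T.starProjection u‖ ≤ c := by
  have h1 := h _ (T.starProjection_apply_mem u)
  have h2 : inner ℝ u (T.starProjection u) = ‖T.starProjection u‖ ^ 2 := by
    have h3 := Submodule.starProjection_inner_eq_zero u _ (T.starProjection_apply_mem u)
    rw [inner_sub_left, real_inner_self_eq_norm_sq] at h3
    linarith
  rw [h2] at h1
  by_contra! hlt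
  nlinarith [norm_nonneg (T.starProjection u)]

/-- `H` is constant along curves in `M`, which kills their velocities; the kernel is a subspace, so
it contains their span. -/
theorem tangentSpaceOf_le_ker {d : ℕ} {S : Type*} [NormedAddCommGroup S] [NormedSpace ℝ S]
    {M : Set (EuclideanSpace ℝ (Fin d))} {x : EuclideanSpace ℝ (Fin d)}
    {H : EuclideanSpace ℝ (Fin d) → S} {b : S} (hH : DifferentiableAt ℝ H x)
    (hM : ∀ᶠ z in 𝓝 x, z ∈ M → H z = b) {v : EuclideanSpace ℝ (Fin d)}
    (hv : v ∈ tangentSpaceOf M x) : fderiv ℝ H x v = 0 := by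
  suffices tangentSpaceOf M x ≤ LinearMap.ker (fderiv ℝ H x : _ →ₗ[ℝ] S) from this hv
  refine Submodule.span_le.2 ?_
  rintro _ ⟨γ, hγ, rfl, hγM, rfl⟩
  have hc : HasDerivAt (fun t => H (γ t)) (fderiv ℝ H (γ 0) (deriv γ 0)) 0 :=
    HasFDerivAt.comp_hasDerivAt (l := H) (0 : ℝ) hH.hasFDerivAt
      (hγ.differentiableAt one_ne_zero).hasDerivAt
  refine hc.unique ((hasDerivAt_const (0 : ℝ) b).congr_of_eventuallyEq ?_)
  filter_upwards [hγM, hγ.continuousAt.eventually hM] with t h1 h2 using h2 h1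

/-- Bounds that hold on an open set for the elements of `∇̃f` pass to `∇̂f`. -/
theorem normalizedSubdiff_induction {n : ℕ} {f : EuclideanSpace ℝ (Fin n) → ℝ}
    {W : Set (EuclideanSpace ℝ (Fin n))} (hW : IsOpen W)
    {p : EuclideanSpace ℝ (Fin n) → EuclideanSpace ℝ (Fin n) → Prop}
    (hp : IsClosed {q : EuclideanSpace ℝ (Fin n) × EuclideanSpace ℝ (Fin n) | p q.1 q.2})
    (h : ∀ y ∈ W, ∀ u ∈ preNormalizedSubdiff f y, p y u) :
    ∀ y ∈ W, ∀ u ∈ normalizedSubdiff f y, p y u := by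
  intro y hy u hu
  have hu' : (y, u) ∈ closure {q : EuclideanSpace ℝ (Fin n) × EuclideanSpace ℝ (Fin n) |
    q.2 ∈ preNormalizedSubdiff f q.1} := hu
  by_contra hn
  have hmem : {q : EuclideanSpace ℝ (Fin n) × EuclideanSpace ℝ (Fin n) | p q.1 q.2}ᶜ ∩
      Prod.fst ⁻¹' W ∈ 𝓝 (y, u) :=
    (hp.isOpen_compl.inter (hW.preimage continuous_fst)).mem_nhds ⟨hn, hy⟩
  obtain ⟨q, ⟨hq1, hq2⟩, hq3⟩ := mem_closure_iff_nhds.1 hu' _ hmem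
  exact hq1 (h _ hq2 _ hq3)

/-! ### The formula along a level set -/

/-- The formula for functions which are constant on the level sets of a `C²` submersion `H`, along
the level set of `H` through `a`. -/
theorem submersion_projection_formula {n : ℕ} {S : Type*} [NormedAddCommGroup S] [NormedSpace ℝ S]
    [FiniteDimensional ℝ S] {f : EuclideanSpace ℝ (Fin n) → ℝ}
    {H : EuclideanSpace ℝ (Fin n) → S} {a : EuclideanSpace ℝ (Fin n)}
    {M W : Set (EuclideanSpace ℝ (Fin n))} (hH : ContDiffAt ℝ 2 H a)
    (hs : Function.Surjective (fderiv ℝ H a)) (hW : W ∈ 𝓝 a)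
    (hM : ∀ x ∈ W, x ∈ M ↔ H x = H a)
    (hf : ∀ x ∈ W, ∀ y ∈ W, H x = H y → f x = f y) :
    IsEmbeddedSubmanifoldNear 2 M a ∧
      ∃ c r : ℝ, 0 < c ∧ 0 < r ∧
        ∀ x ∈ M ∩ Metric.ball a r, ∀ y ∈ Metric.ball a r, ∀ u ∈ normalizedSubdiff f y,
          ‖(tangentSpaceOf M x).starProjection u‖ ≤ c * ‖x - y‖ := by
  obtain ⟨φ, haφ, hφW, hφ, hψ, hφH⟩ :=
    ContDiffAt.exists_straightening (k := 2) one_le_two hH hs hW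
  refine ⟨⟨(hM a (mem_of_mem_nhds hW)).2 rfl, φ, LinearMap.ker (fderiv ℝ H a : _ →ₗ[ℝ] S), haφ,
    hφ, hψ, fun x hx => ?_⟩, ?_⟩
  · rw [hM x (hφW hx), LinearMap.mem_ker, ContinuousLinearMap.coe_coe, hφH, sub_eq_zero]
  have hdH : ContDiffAt ℝ 1 (fderiv ℝ H) a := hH.fderiv_right (by norm_num)
  obtain ⟨L, t, ht, hL⟩ := hdH.exists_lipschitzOnWith
  obtain ⟨C, hC, hpre⟩ := hdH.continuousAt.exists_bounded_preimage hs
  obtain ⟨r, hr, hball⟩ := Metric.eventually_nhds_iff_ball.1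
    (Filter.Eventually.and (φ.open_source.mem_nhds haφ) (Filter.Eventually.and ht (hpre.and
      (hH.eventually (by simp)))))
  -- The `+ 1` only keeps the constant positive when `L = 0`.
  refine ⟨C * L + 1, r, by positivity, hr, fun x hx => ?_⟩
  obtain ⟨hxM, hxr⟩ := hx
  -- For fixed `x` the estimate is a closed condition on `(y, u)`.
  refine normalizedSubdiff_induction Metric.isOpen_ball
    (p := fun y u => ‖(tangentSpaceOf M x).starProjection u‖ ≤ (C * L + 1) * ‖x - y‖)
    (isClosed_le (by fun_prop) (by fun_prop)) fun y hy u hu => ?_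
  obtain ⟨hxs, hxt, -, hxH⟩ := hball x hxr
  obtain ⟨hys, hyt, hyp, -⟩ := hball y hy
  rcases hu with ⟨hd, hne, rfl⟩ | ⟨-, rfl⟩
  swap
  · rw [map_zero, norm_zero]; positivity
  refine norm_starProjection_le_of_inner_le (fun v hv => ?_) (by positivity)
  have hxv : fderiv ℝ H x v = 0 := by
    refine tangentSpaceOf_le_ker (hxH.differentiableAt two_ne_zero) (b := H a) ?_ hv
    filter_upwards [φ.open_source.mem_nhds hxs] with z hz using (hM z (hφW hz)).1
  -- `v - v'` lies in `ker dH_y`, and `v'` is as small as `dH_y v`.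
  obtain ⟨v', hv', hnv'⟩ := hyp (fderiv ℝ H y v)
  have hker : fderiv ℝ f y (v - v') = 0 :=
    fderiv_apply_eq_zero_of_straightening (hφ.of_le (by norm_num)) (hψ.of_le (by norm_num)) hφH
      (fun z hz w hw => hf z (hφW hz) w (hφW hw)) hys hd (by rw [map_sub, hv', sub_self])
  set u := ‖gradient f y‖⁻¹ • gradient f y with hu
  have hnu : ‖u‖ = 1 := by
    rw [hu, norm_smul, norm_inv, norm_norm, inv_mul_cancel₀ (norm_ne_zero_iff.2 hne)]
  have hinner : inner ℝ u v = inner ℝ u v' := by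
    have : inner ℝ (gradient f y) (v - v') = 0 := by rw [inner_gradient_left, hker]
    rw [← sub_eq_zero, ← inner_sub_right, hu, real_inner_smul_left, this, mul_zero]
  have hyv : ‖fderiv ℝ H y v‖ ≤ L * ‖x - y‖ * ‖v‖ := by
    calc ‖fderiv ℝ H y v‖ = ‖(fderiv ℝ H x - fderiv ℝ H y) v‖ := by
          rw [sub_apply, hxv, zero_sub, norm_neg]
      _ ≤ ‖fderiv ℝ H x - fderiv ℝ H y‖ * ‖v‖ := ContinuousLinearMap.le_opNorm _ _
      _ ≤ L * ‖x - y‖ * ‖v‖ := by gcongr; exact hL.norm_sub_le hxt hyt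
  calc inner ℝ u v = inner ℝ u v' := hinner
    _ ≤ ‖u‖ * ‖v'‖ := real_inner_le_norm _ _
    _ ≤ C * (L * ‖x - y‖ * ‖v‖) := by rw [hnu, one_mul]; exact hnv'.trans (by gcongr)
    _ = (C * L) * ‖x - y‖ * ‖v‖ := by ring
    _ ≤ (C * L + 1) * ‖x - y‖ * ‖v‖ := by gcongr; linarith

/-! ### Reduction to a submersion -/

theorem mainTheorem5 {n m : ℕ} (g : EuclideanSpace ℝ (Fin m) → ℝ)
    (F : EuclideanSpace ℝ (Fin n) → EuclideanSpace ℝ (Fin m))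
    (a : EuclideanSpace ℝ (Fin n))
    (U : Set (EuclideanSpace ℝ (Fin n))) (V : Set (EuclideanSpace ℝ (Fin m)))
    (hg : LowerSemicontinuous g) (hg' : IsPositiveDefiniteFun g)
    (ha : g (F a) = 0) (hF : ContDiffAt ℝ 2 F a)
    (hU : IsOpen U) (haU : a ∈ U)
    (hV : IsEmbeddedSubmanifoldNear 2 V (F a)) (hUV : MapsTo F U V)
    (hsurj : SurjOn (fderiv ℝ F a) univ (tangentSpaceOf V (F a)))
    (hfib : F ⁻¹' {F a} ⊆ U) :
    IsEmbeddedSubmanifoldNear 2 {x | g (F x) = 0} a ∧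
      NormalizedPerturbedProjectionFormula (g ∘ F) a {x | g (F x) = 0} := by
  have hzero : ∀ y, g y = 0 ↔ y = 0 := fun y =>
    ⟨fun h => by_contra fun hy => (hg'.2 y hy).ne' h, fun h => h ▸ hg'.1⟩
  have hFa : F a = 0 := (hzero _).1 ha
  obtain ⟨hpV, φ, S, hp, hφ, hψ, hS⟩ := hV
  have hpt : φ (F a) ∈ φ.target := φ.map_source hp
  have hφc : ContDiffAt ℝ 2 φ (F a) := hφ.contDiffAt (φ.open_source.mem_nhds hp)
  have hψc : ContDiffAt ℝ 2 φ.symm (φ (F a)) := hψ.contDiffAt (φ.open_target.mem_nhds hpt)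
  have hφd : HasFDerivAt φ (fderiv ℝ φ (F a)) (F a) :=
    (hφc.differentiableAt two_ne_zero).hasFDerivAt
  have hψd : HasFDerivAt φ.symm (fderiv ℝ φ.symm (φ (F a))) (φ (F a)) :=
    (hψc.differentiableAt two_ne_zero).hasFDerivAt
  -- The projection turns `φ ∘ F` into a map with values in `S` everywhere; on `U ∩ F ⁻¹' φ.source`
  -- it changes nothing (`hval`).
  set H : EuclideanSpace ℝ (Fin n) → S := fun x => S.orthogonalProjectionOnto (φ (F x)) with hHdef
  have hH : ContDiffAt ℝ 2 H a :=
    S.orthogonalProjectionOnto.contDiff.contDiffAt.comp a (hφc.comp a hF)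
  have hHd : HasFDerivAt H
      (S.orthogonalProjectionOnto.comp ((fderiv ℝ φ (F a)).comp (fderiv ℝ F a))) a :=
    S.orthogonalProjectionOnto.hasFDerivAt.comp a
      (hφd.comp a (hF.differentiableAt two_ne_zero).hasFDerivAt)
  have hs : Function.Surjective (fderiv ℝ H a) := by
    rintro ⟨s, hsS⟩
    -- The chart pulls the line `φ (F a) + t • s` in `S` back to a curve in `V`. A preimage under
    -- `dF_a` of its velocity is then mapped to `s` by `dH_a`.
    have hw : fderiv ℝ φ.symm (φ (F a)) s ∈ tangentSpaceOf V (F a) := by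
      refine Submodule.subset_span ?_
      have hline : HasDerivAt (fun t : ℝ => φ (F a) + t • s) s 0 := by
        simpa using ((hasDerivAt_id (0 : ℝ)).smul_const s).const_add (φ (F a))
      have hlc : ContDiff ℝ 1 (fun t : ℝ => φ (F a) + t • s) := by fun_prop
      have h0 : φ (F a) + (0 : ℝ) • s = φ (F a) := by simp
      refine ⟨fun t => φ.symm (φ (F a) + t • s), ?_, by simp [φ.left_inv hp], ?_, ?_⟩
      · refine ContDiffAt.comp (g := φ.symm) (0 : ℝ) ?_ hlc.contDiffAt
        rw [h0]; exact hψc.of_le (by norm_num)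
      · have : ∀ᶠ t in 𝓝 (0 : ℝ), φ (F a) + t • s ∈ φ.target := by
          refine hlc.continuous.continuousAt.eventually_mem ?_
          rw [h0]; exact φ.open_target.mem_nhds hpt
        filter_upwards [this] with t ht
        rw [hS _ (φ.map_target ht), φ.right_inv ht]
        exact S.add_mem ((hS _ hp).1 hpV) (S.smul_mem t hsS)
      · exact (HasFDerivAt.comp_hasDerivAt (l := φ.symm) (0 : ℝ) (by rw [h0]; exact hψd)
          hline).deriv
    obtain ⟨x, -, hx⟩ := hsurj hw
    refine ⟨x, ?_⟩
    have hid : fderiv ℝ φ (F a) (fderiv ℝ φ.symm (φ (F a)) s) = s := by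
      have h1 : HasFDerivAt (fun z => φ (φ.symm z))
          ((fderiv ℝ φ (F a)).comp (fderiv ℝ φ.symm (φ (F a)))) (φ (F a)) :=
        HasFDerivAt.comp (g := φ) (φ (F a)) (by rw [φ.left_inv hp]; exact hφd) hψd
      have h2 : HasFDerivAt (fun z => φ (φ.symm z)) (ContinuousLinearMap.id ℝ _) (φ (F a)) :=
        (hasFDerivAt_id _).congr_of_eventuallyEq <| by
          filter_upwards [φ.open_target.mem_nhds hpt] with z hz using φ.right_inv hz
      exact DFunLike.congr_fun (h1.unique h2) s
    rw [hHd.fderiv, ContinuousLinearMap.comp_apply, ContinuousLinearMap.comp_apply, hx, hid]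
    exact S.orthogonalProjectionOnto_mem_subspace_eq_self ⟨s, hsS⟩
  have hW : U ∩ F ⁻¹' φ.source ∈ 𝓝 a :=
    inter_mem (hU.mem_nhds haU) (hF.continuousAt (φ.open_source.mem_nhds hp))
  have hval : ∀ x ∈ U ∩ F ⁻¹' φ.source, (H x : EuclideanSpace ℝ (Fin m)) = φ (F x) :=
    fun x hx => S.starProjection_eq_self_iff.2 ((hS _ hx.2).1 (hUV hx.1))
  have hHF : ∀ x ∈ U ∩ F ⁻¹' φ.source, ∀ y ∈ U ∩ F ⁻¹' φ.source, H x = H y → F x = F y := by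
    intro x hx y hy hxy
    refine φ.injOn hx.2 hy.2 ?_
    rw [← hval x hx, ← hval y hy, hxy]
  have key := submersion_projection_formula (f := g ∘ F) (M := {x | g (F x) = 0}) hH hs hW
    (fun x hx => by
      rw [mem_ofPred_eq, hzero, ← hFa]
      exact ⟨fun h => by simp only [hHdef, h], hHF x hx a (mem_of_mem_nhds hW)⟩)
    (fun x hx y hy hxy => congrArg g (hHF x hx y hy hxy))
  refine ⟨key.1, ?_, fun x hx => ?_, key.2⟩
  · obtain ⟨h0, φ', S', h1, h2, h3, h4⟩ := key.1
    exact ⟨h0, φ', S', h1, h2.of_le (by norm_num), h3.of_le (by norm_num), h4⟩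
  · exact (show g (F x) = 0 from hx).trans ha.symm
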